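/- The Aztec diamond $AD_n$ of order $n\ge 0$ is the graph whose vertices are the white squares of a $(2n+1)\times(2n+1)$ chessboard with black corners, two white squares being joined by an edge exactly when they are diagonally adjacent ($AD_0$ is the empty graph). Number the rows of the board $0,\dots,2n$ from north to south and its columns $0,\dots,2n$ from west to east. The edges of $AD_n$ are partitioned into $n^2$ four-cycles, namely those formed by the four white squares that share a side with a black square in an odd row and an odd column; the cycles around the black squares of board column $2k-1$ form the $k$-th column of cycles, $1\le k\le n$. Let $x_i,y_i,z_i,w_i$ $(i\ge 1)$ be elements of a commutative ring (for instance, independent variables). For $a\ge 1$ let $(AD_n;\,a\le i\le a+n-1)$ denote $AD_n$ with the following edge weights: in every cycle of the $k$-th column the northwestern, northeastern, southeastern and southwestern edges have the weights $x_i,y_i,w_i,z_i$, respectively, where $i=a+k-1$. The weight of a perfect matching is the product of the weights of its edges, and $M(AD_n;\,a\le i\le a+n-1)$ denotes the sum of the weights of all perfect matchings (so that $M=1$ for $n=0$). Then, for every $n\ge 2$, $$M(AD_n;1\le i\le n)\,M(AD_{n-2};2\le i\le n-1)=(x_1w_n+y_nz_1)\,M(AD_{n-1};1\le i\le n-1)\,M(AD_{n-1};2\le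 i\le n),$$ and, for every $n\ge 0$, $$M(AD_n;1\le i\le n)=\prod_{1\le i\le j\le n}(x_iw_j+z_iy_j).$$ -/

import Mathlib

/-- The sum of the weights of all perfect matchings of the finite graph `G` with edge weights `ω`,
the weight of a perfect matching being the product of the weights of its edges. -/
noncomputable def matchingSum {V R : Type*} [Finite V] [CommRing R]
    (G : SimpleGraph V) (ω : Sym2 V → R) : R :=
  ∑ P ∈ (Set.toFinite {P : G.Subgraph | P.IsPerfectMatching}).toFinset,
    ∏ e ∈ (Set.toFinite P.edgeSet).toFinset, ω e

namespace Aztec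

/-- The white squares of a `(2n+1) × (2n+1)` chessboard with black corners. The square
`(r, c)` lies in row `r`, counted from the north, and column `c`, counted from the west, both
starting with `0`; the corner `(0, 0)` is black, so the white squares are those with `r + c` odd. -/
abbrev Vertex (n : ℕ) : Type :=
  {p : Fin (2 * n + 1) × Fin (2 * n + 1) // Odd ((p.1 : ℕ) + (p.2 : ℕ))}

/-- The row of a white square. -/
def Vertex.row {n : ℕ} (p : Vertex n) : ℕ := p.1.1

/-- The column of a white square. -/
def Vertex.col {n : ℕ} (p : Vertex n) : ℕ := p.1.2

/-- The Aztec diamond of order `n`: white squares are joined when they are diagonally adjacent. -/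
def diamond (n : ℕ) : SimpleGraph (Vertex n) where
  Adj p q := (p.row + 1 = q.row ∨ q.row + 1 = p.row) ∧ (p.col + 1 = q.col ∨ q.col + 1 = p.col)
  symm := ⟨fun _ _ h => ⟨h.1.symm, h.2.symm⟩⟩
  loopless := ⟨fun p h => by rcases h.1 with h | h <;> omega⟩

variable {R : Type*} [CommRing R]

/-- The edges of the Aztec diamond are partitioned into `n * n` four-cycles, those around the black
squares `(r, c)` with `r` and `c` odd. Such a cycle has the northern and southern vertices
`(r - 1, c)`, `(r + 1, c)` (even row) and the western and eastern vertices
`(r, c - 1)`, `(r, c + 1)` (odd row). Here `p` is the northern or southern end of an edge of the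
cycle, `q` is its western or eastern end, and `i` is the index of the variables
given to the cycle: the northinrern, northeastern, southeastern and southinrern edges have
the weights `x i`, `y i`, `w i`, `z i`. -/
def sideWeight (x y z w : ℕ → R) {n : ℕ} (i : ℕ) (p q : Vertex n) : R :=
  if p.row < q.row then
    if q.col < p.col then x i else y i
  else
    if p.col < q.col then w i else z i

/-- The edge weights of `(AD_n; a ≤ i ≤ a + n - 1)`: the four-cycles in the `k`-th column
(`k = 1, …, n`), that is, those around the squares in column `2 * k - 1` of the board, get the
variables with index `a + k - 1`. Every edge has exactly one end in an even row. Pairs that are not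
edges never matter. -/
def weight (x y z w : ℕ → R) (n a : ℕ) : Sym2 (Vertex n) → R :=
  Sym2.lift ⟨fun p q =>
    if Even p.row ∧ Odd q.row then sideWeight x y z w (a + p.col / 2) p q
    else if Even q.row ∧ Odd p.row then sideWeight x y z w (a + q.col / 2) q p
    else 0, by
      intro p q
      by_cases hp : Even p.row <;> by_cases hq : Even q.row <;>
        simp [hp, hq, ← Nat.not_even_iff_odd]⟩

/-- `M(AD_n; a ≤ i ≤ a + n - 1)`, the sum of the weights of the perfect matchings of the Aztec
diamond of order `n` whose columns of four-cycles are weighted with the indices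
`a, a + 1, …, a + n - 1` from west to east. -/
noncomputable def M (x y z w : ℕ → R) (n a : ℕ) : R :=
  matchingSum (diamond n) (weight x y z w n a)

end Aztec

/-!
Urban renewal. Distribute the ends of the edges of a perfect matching of the Aztec diamond of order
`m + 1` over its four-cycles: every vertex is allotted to the four-cycle of the edge that covers it,
and the matching is recovered by choosing in each four-cycle a perfect matching of the allotted
corners. A vertex of the border of the board lies on one four-cycle and every other vertex on two,
so allotting to each four-cycle the complementary set of corners leaves the border uncovered and
covers every interior vertex once. The interior is an Aztec diamond of order `m`, with weights that
are again constant along columns when opposite sides of each four-cycle are interchanged.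

Within one four-cycle, with `Δ` the sum of its two perfect matchings, exchanging a set of corners
for its complement and every side for its opposite turns the sum `Δ` into `1` if all corners are
allotted, turns `1` into `Δ` if none are, and does not change the sum otherwise. In a column of
`m + 1` four-cycles the northern and southern corners are `m + 2` vertices, so the first case occurs
once more than the second and the column contributes one factor `Δ`. This expresses the weight sum
for order `m + 1` through that for order `m` with `y` and `w` shifted by one index; iterating gives
the product formula, and condensation follows from it.
-/

open Finset

/-- The members of the family `A` indexed by `F` cover every point of `S` once and no other point.
For the family of the edges of a graph, viewed as sets of two vertices, and `S` the set of all
vertices, this says that `F` is a perfect matching. -/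
def IsExactCover {ι V : Type*} [DecidableEq V] (A : ι → Finset V) (S : Finset V)
    (F : Finset ι) : Prop :=
  ∀ v, #{i ∈ F | v ∈ A i} = if v ∈ S then 1 else 0

instance {ι V : Type*} [DecidableEq V] [Fintype V] (A : ι → Finset V) (S : Finset V)
    (F : Finset ι) : Decidable (IsExactCover A S F) :=
  inferInstanceAs (Decidable (∀ v, #{i ∈ F | v ∈ A i} = if v ∈ S then 1 else 0))

/-- The sum of the weights of the exact covers of `S` by members of the family `A`, the weight of a
cover being the product of the weights `ω i` of its members. -/
def coverSum {ι V R : Type*} [Fintype ι] [Fintype V] [DecidableEq V] [CommSemiring R]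
    (A : ι → Finset V) (ω : ι → R) (S : Finset V) : R :=
  ∑ F : Finset ι with IsExactCover A S F, ∏ i ∈ F, ω i

namespace IsExactCover

variable {ι V : Type*} [DecidableEq V] {A : ι → Finset V} {S : Finset V} {F : Finset ι}

theorem subset (hF : IsExactCover A S F) {i : ι} (hi : i ∈ F) : A i ⊆ S := by
  intro v hv
  by_contra hS
  have hempty : #{i ∈ F | v ∈ A i} = 0 := (hF v).trans (if_neg hS)
  exact filter_eq_empty_iff.1 (card_eq_zero.1 hempty) hi hv

theorem biUnion_eq (hF : IsExactCover A S F) : F.biUnion A = S := by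
  refine (biUnion_subset.2 fun i hi => hF.subset hi).antisymm fun v hv => ?_
  have hone : #{i ∈ F | v ∈ A i} = 1 := (hF v).trans (if_pos hv)
  obtain ⟨i, hi⟩ := card_pos.1 (hone ▸ one_pos)
  exact mem_biUnion.2 ⟨i, mem_filter.1 hi⟩

theorem sum_card_inter (hF : IsExactCover A S F) {B : Finset V} (hB : B ⊆ S) :
    ∑ i ∈ F, #(B ∩ A i) = #B := by
  calc ∑ i ∈ F, #(B ∩ A i) = ∑ v ∈ B, #{i ∈ F | v ∈ A i} := by
        simp only [← filter_mem_eq_inter]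
        exact sum_card_bipartiteAbove_eq_sum_card_bipartiteBelow fun i v => v ∈ A i
    _ = ∑ v ∈ B, 1 := sum_congr rfl fun v hv => (hF v).trans (if_pos (hB hv))
    _ = #B := (card_eq_sum_ones B).symm

end IsExactCover

theorem isExactCover_biUnion {ι V : Type*} [DecidableEq V] {A : ι → Finset V} {F : Finset ι}
    (hF : ∀ v, #{i ∈ F | v ∈ A i} ≤ 1) : IsExactCover A (F.biUnion A) F := by
  intro v
  split_ifs with hv
  · obtain ⟨i, hi⟩ := mem_biUnion.1 hv
    exact (hF v).antisymm (card_pos.2 ⟨i, mem_filter.2 hi⟩)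
  · rw [card_eq_zero, filter_eq_empty_iff]
    exact fun i hi hvi => hv (mem_biUnion.2 ⟨i, hi, hvi⟩)

section Transport

variable {ι κ V W : Type*} [DecidableEq V] [DecidableEq W] {A : ι → Finset V} {B : κ → Finset W}

theorem isExactCover_map_iff (ψ : ι ↪ κ) (φ : V ↪ W) (hB : ∀ i, B (ψ i) = (A i).map φ)
    {S : Finset V} {F : Finset ι} :
    IsExactCover B (S.map φ) (F.map ψ) ↔ IsExactCover A S F := by
  have hcard (w : W) : #{k ∈ F.map ψ | w ∈ B k} = #{i ∈ F | w ∈ (A i).map φ} := by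
    simp only [filter_map, card_map, Function.comp_def, hB]
  simp only [IsExactCover, hcard]
  refine ⟨fun h v => by simpa only [mem_map'] using h (φ v), fun h w => ?_⟩
  by_cases hw : ∃ v, φ v = w
  · obtain ⟨v, rfl⟩ := hw
    simpa only [mem_map'] using h v
  · have hnot (T : Finset V) : w ∉ T.map φ := fun hT =>
      hw ((mem_map.1 hT).imp fun _ hv => hv.2)
    simp only [hnot, filter_false, card_empty, if_false]

theorem coverSum_map {R : Type*} [CommSemiring R] [Fintype ι] [Fintype κ] [Fintype V] [Fintype W]
    (ψ : ι ↪ κ) (φ : V ↪ W) (hB : ∀ i, B (ψ i) = (A i).map φ) {S : Finset V}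
    (hψ : ∀ k, B k ⊆ S.map φ → k ∈ Set.range ψ) (ω : κ → R) :
    coverSum B ω (S.map φ) = coverSum A (ω ∘ ψ) S := by
  refine (sum_nbij (Finset.map ψ) (fun F hF => ?_) ((map_injective ψ).injOn) (fun K hK => ?_)
    fun F _ => (prod_map F ψ ω).symm).symm
  · simpa only [mem_filter_univ, isExactCover_map_iff ψ φ hB] using hF
  · have hK : IsExactCover B (S.map φ) K := by simpa using hK
    have hsub : K ⊆ univ.map ψ := fun k hk => by simpa using hψ k (hK.subset hk)
    obtain ⟨F, -, rfl⟩ := subset_map_iff.1 hsub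
    exact ⟨F, by simpa [isExactCover_map_iff ψ φ hB] using hK, rfl⟩

end Transport

section Matching

variable {V : Type*} {G : SimpleGraph V}

theorem isPerfectMatching_iff_card_edges_eq_one [Finite V] [DecidableEq V] {P : G.Subgraph} :
    P.IsPerfectMatching ↔
      P.IsSpanning ∧ ∀ v, #{e ∈ (Set.toFinite P.edgeSet).toFinset | v ∈ e} = 1 := by
  classical
  have := Fintype.ofFinite V
  have hdegree (v : V) : #{e ∈ (Set.toFinite P.edgeSet).toFinset | v ∈ e} = P.degree v := by
    rw [← P.degree_spanningCoe, ← SimpleGraph.card_incidenceFinset_eq_degree]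
    congr 1
    ext e
    simp [SimpleGraph.incidenceSet]
  simp only [hdegree, ← SimpleGraph.Subgraph.isPerfectMatching_iff_forall_degree]
  exact ⟨fun h => ⟨h.2, h⟩, And.right⟩

theorem eq_of_isSpanning_of_edgeSet_eq {P Q : G.Subgraph} (hP : P.IsSpanning) (hQ : Q.IsSpanning)
    (h : P.edgeSet = Q.edgeSet) : P = Q :=
  SimpleGraph.Subgraph.ext (hP.verts_eq_univ.trans hQ.verts_eq_univ.symm) <| by
    ext u v
    rw [← SimpleGraph.Subgraph.mem_edgeSet, h, SimpleGraph.Subgraph.mem_edgeSet]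

theorem exists_isSpanning_edgeSet_eq {E : Set (Sym2 V)} (hE : E ⊆ G.edgeSet) :
    ∃ P : G.Subgraph, P.IsSpanning ∧ P.edgeSet = E := by
  have hdiag : E \ Sym2.diagSet = E := sdiff_eq_left.2 <|
    Set.disjoint_left.2 fun e he => G.not_isDiag_of_mem_edgeSet (hE he)
  have hle : SimpleGraph.fromEdgeSet E ≤ G := by
    rwa [← SimpleGraph.edgeSet_subset_edgeSet, SimpleGraph.edgeSet_fromEdgeSet, hdiag]
  exact ⟨SimpleGraph.toSubgraph _ hle, SimpleGraph.toSubgraph.isSpanning _ hle,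
    (SimpleGraph.edgeSet_fromEdgeSet E).trans hdiag⟩

theorem exists_isPerfectMatching_edgeSet_eq [Finite V] [DecidableEq V] {E : Finset (Sym2 V)}
    (hE : (E : Set (Sym2 V)) ⊆ G.edgeSet) (hcard : ∀ v, #{e ∈ E | v ∈ e} = 1) :
    ∃ P : G.Subgraph, P.IsPerfectMatching ∧ (Set.toFinite P.edgeSet).toFinset = E := by
  obtain ⟨P, hspan, hP⟩ := exists_isSpanning_edgeSet_eq hE
  have hedges : (Set.toFinite P.edgeSet).toFinset = E := by
    ext e
    simp [hP]
  exact ⟨P, isPerfectMatching_iff_card_edges_eq_one.2 ⟨hspan, hedges ▸ hcard⟩, hedges⟩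

theorem matchingSum_eq_coverSum {ι R : Type*} [Fintype ι] [Fintype V] [DecidableEq V] [CommRing R]
    (edge : ι ≃ G.edgeSet) (ω : Sym2 V → R) :
    matchingSum G ω =
      coverSum (fun i => (edge i : Sym2 V).toFinset) (fun i => ω (edge i)) univ := by
  classical
  let toSym2 : ι ↪ Sym2 V := edge.toEmbedding.trans (Function.Embedding.subtype _)
  have hcover (F : Finset ι) : IsExactCover (fun i => (edge i : Sym2 V).toFinset) univ F ↔
      ∀ v, #{e ∈ F.map toSym2 | v ∈ e} = 1 := by
    simp [IsExactCover, filter_map, toSym2]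
  let indices (P : G.Subgraph) : Finset ι := {i | (edge i : Sym2 V) ∈ P.edgeSet}
  have hindices (P : G.Subgraph) : (indices P).map toSym2 = (Set.toFinite P.edgeSet).toFinset := by
    ext e
    simp only [indices, Set.Finite.mem_toFinset, mem_map, mem_filter_univ]
    refine ⟨?_, fun he => ?_⟩
    · rintro ⟨i, hi, rfl⟩
      exact hi
    · exact ⟨edge.symm ⟨e, P.edgeSet_subset he⟩, by simpa using he, by simp [toSym2]⟩
  refine sum_nbij indices (fun P hP => ?_) (fun P hP Q hQ hPQ => ?_) (fun F hF => ?_)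
    fun P _ => by rw [← hindices, prod_map]; rfl
  · rw [mem_filter_univ, hcover, hindices]
    exact (isPerfectMatching_iff_card_edges_eq_one.1 (by simpa using hP)).2
  · have hP : P.IsPerfectMatching := by simpa using hP
    have hQ : Q.IsPerfectMatching := by simpa using hQ
    have hedges := congrArg (Finset.map toSym2) hPQ
    rw [hindices, hindices, Set.Finite.toFinset_inj] at hedges
    exact eq_of_isSpanning_of_edgeSet_eq hP.2 hQ.2 hedges
  · have hF : IsExactCover (fun i => (edge i : Sym2 V).toFinset) univ F := by simpa using hF
    have hsub : (F.map toSym2 : Set (Sym2 V)) ⊆ G.edgeSet := by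
      rintro e he
      obtain ⟨i, -, rfl⟩ := mem_map.1 he
      exact (edge i).2
    obtain ⟨P, hP, hedges⟩ := exists_isPerfectMatching_edgeSet_eq hsub ((hcover F).1 hF)
    exact ⟨P, by simpa using hP, map_injective toSym2 ((hindices P).trans hedges)⟩

end Matching

theorem isExactCover_compl_iff {C κ W : Type*} [Fintype C] [Fintype κ] [DecidableEq κ]
    [DecidableEq W] {corner : C → κ ↪ W} {S S' : Finset W}
    (hS : ∀ w, #{γ | w ∈ univ.map (corner γ)} =
      (if w ∈ S then 1 else 0) + if w ∈ S' then 1 else 0) {t : C → Finset κ} :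
    IsExactCover (fun γ => (t γ)ᶜ.map (corner γ)) S' univ ↔
      IsExactCover (fun γ => (t γ).map (corner γ)) S univ := by
  classical
  have hsplit (w : W) : #{γ | w ∈ (t γ).map (corner γ)} + #{γ | w ∈ (t γ)ᶜ.map (corner γ)} =
      #{γ | w ∈ univ.map (corner γ)} := by
    rw [← card_union_of_disjoint, ← filter_or]
    · simp only [← mem_union, ← map_union, union_compl]
    · refine disjoint_filter.2 fun γ _ h => ?_
      exact disjoint_left.1 ((disjoint_map _).2 disjoint_compl_right) h
  refine forall_congr' fun w => ?_
  have := hsplit w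
  have := hS w
  dsimp only
  omega

section Cells

variable {C κ δ W R : Type*} [Fintype C] [DecidableEq C] [Fintype κ] [DecidableEq κ] [Fintype δ]
  [Fintype W] [DecidableEq W] [CommSemiring R]

theorem coverSum_prod_eq_sum_pi (B : C × δ → Finset W) (ω : C × δ → R) (S : Finset W) :
    coverSum B ω S =
      ∑ p : C → Finset δ with ∀ w, ∑ γ, #{d ∈ p γ | w ∈ B (γ, d)} = if w ∈ S then 1 else 0,
        ∏ γ, ∏ d ∈ p γ, ω (γ, d) := by
  classical
  have hcard (F : Finset (C × δ)) (w : W) :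
      #{x ∈ F | w ∈ B x} = ∑ γ, #{d ∈ ({d | (γ, d) ∈ F} : Finset δ) | w ∈ B (γ, d)} := by
    simp only [card_eq_sum_ones]
    exact sum_finset_product _ _ _ fun x => by simp
  refine sum_nbij' (fun F γ => {d | (γ, d) ∈ F})
    (fun p : C → Finset δ => ({x | x.2 ∈ p x.1} : Finset (C × δ)))
    (fun F hF => ?_) (fun p hp => ?_) (fun F _ => by ext; simp) (fun p _ => by ext; simp)
    fun F _ => prod_finset_product _ _ _ fun x => by simp
  · simpa only [mem_filter_univ, IsExactCover, hcard] using hF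
  · simpa [IsExactCover, hcard] using hp

theorem coverSum_cells (A : δ → Finset κ) (corner : C → κ ↪ W) (ω : C × δ → R) (S : Finset W) :
    coverSum (fun x : C × δ => (A x.2).map (corner x.1)) ω S =
      ∑ t : C → Finset κ with IsExactCover (fun γ => (t γ).map (corner γ)) S univ,
        ∏ γ, coverSum A (fun d => ω (γ, d)) (t γ) := by
  classical
  rw [coverSum_prod_eq_sum_pi]
  simp only [coverSum, prod_univ_sum]
  have hlocal {t : C → Finset κ} {p : C → Finset δ} (h : ∀ γ, IsExactCover A (t γ) (p γ)) (w : W) :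
      ∑ γ, #{d ∈ p γ | w ∈ (A d).map (corner γ)} = #{γ | w ∈ (t γ).map (corner γ)} := by
    rw [card_filter]
    refine sum_congr rfl fun γ _ => ?_
    simpa using (isExactCover_map_iff (B := fun d => (A d).map (corner γ))
      (Function.Embedding.refl δ) (corner γ) fun _ => rfl).2 (h γ) w
  have hcover {p : C → Finset δ}
      (hp : ∀ w, ∑ γ, #{d ∈ p γ | w ∈ (A d).map (corner γ)} = if w ∈ S then 1 else 0) (γ : C) :
      IsExactCover A ((p γ).biUnion A) (p γ) := by
    refine isExactCover_biUnion fun c => ?_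
    calc #{d ∈ p γ | c ∈ A d} = #{d ∈ p γ | corner γ c ∈ (A d).map (corner γ)} := by
          simp only [mem_map']
      _ ≤ ∑ γ', #{d ∈ p γ' | corner γ c ∈ (A d).map (corner γ')} :=
          single_le_sum (f := fun γ' => #{d ∈ p γ' | corner γ c ∈ (A d).map (corner γ')})
            (fun _ _ => Nat.zero_le _) (mem_univ γ)
      _ ≤ 1 := by rw [hp]; split_ifs <;> simp
  rw [← sum_fiberwise_of_maps_to (g := fun (p : C → Finset δ) γ => (p γ).biUnion A)
    (t := {t | IsExactCover (fun γ => (t γ).map (corner γ)) S univ})]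
  · refine sum_congr rfl fun t ht => sum_congr ?_ fun _ _ => rfl
    ext p
    simp only [mem_filter, mem_univ, true_and, Fintype.mem_piFinset] at ht ⊢
    constructor
    · rintro ⟨hp, rfl⟩
      exact hcover hp
    · exact fun h => ⟨fun w => (hlocal h w).trans (ht w), funext fun γ => (h γ).biUnion_eq⟩
  · intro p hp
    simp only [mem_filter_univ] at hp ⊢
    exact fun w => (hlocal (hcover hp) w).symm.trans (hp w)

end Cells

namespace Aztec

/-- The corners of a four-cycle: `inl s` is the northern (`s = false`) or southern (`s = true`) one,
`inr e` is the western (`e = false`) or eastern (`e = true`) one. -/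
abbrev Corner : Type := Bool ⊕ Bool

/-- The sides of a four-cycle: `(s, e)` joins the corners `inl s` and `inr e`. -/
abbrev Side : Type := Bool × Bool

/-- The set of the two ends of a side. -/
def Side.ends (d : Side) : Finset Corner := {.inl d.1, .inr d.2}

/-- The side opposite to a given one. -/
def Side.opp (d : Side) : Side := (!d.1, !d.2)

section Cycle

variable {R : Type*} [CommSemiring R]

/-- The sum of the weights of the two perfect matchings of a four-cycle. -/
def cycleSum (u : Side → R) : R :=
  u (false, false) * u (true, true) + u (false, true) * u (true, false)

theorem Side.opp_involutive : Function.Involutive Side.opp := fun d => by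
  simp [Side.opp]

theorem Side.ends_opp : ∀ d : Side, d.opp.ends = d.endsᶜ := by
  decide

theorem Side.map_ends {W : Type*} [DecidableEq W] (f : Corner ↪ W) (d : Side) :
    d.ends.map f = {f (.inl d.1), f (.inr d.2)} := by
  rw [Side.ends, map_insert, map_singleton]

theorem Side.card_toLeft_ends : ∀ d : Side, #d.ends.toLeft = 1 := by
  decide

theorem filter_isExactCover_ends_univ :
    ({F | IsExactCover Side.ends univ F} : Finset (Finset Side)) =
      {{(false, false), (true, true)}, {(false, true), (true, false)}} := by
  decide

theorem filter_isExactCover_ends_empty :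
    ({F | IsExactCover Side.ends ∅ F} : Finset (Finset Side)) = {∅} := by
  decide

theorem filter_isExactCover_ends : ∀ t : Finset Corner, t ≠ ∅ → t ≠ univ →
    ({F | IsExactCover Side.ends t F} : Finset (Finset Side)) =
      ({d | d.ends = t} : Finset Side).map ⟨singleton, singleton_injective⟩ := by
  decide

theorem coverSum_ends_univ (u : Side → R) : coverSum Side.ends u univ = cycleSum u := by
  rw [coverSum, filter_isExactCover_ends_univ, sum_pair (by decide), prod_pair (by decide),
    prod_pair (by decide), cycleSum]

theorem coverSum_ends_empty (u : Side → R) : coverSum Side.ends u ∅ = 1 := by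
  rw [coverSum, filter_isExactCover_ends_empty, sum_singleton, prod_empty]

theorem coverSum_ends_eq_sum {t : Finset Corner} (hempty : t ≠ ∅) (huniv : t ≠ univ)
    (u : Side → R) :
    coverSum Side.ends u t = ∑ d with Side.ends d = t, u d := by
  simp [coverSum, filter_isExactCover_ends t hempty huniv]

theorem coverSum_ends_compl {t : Finset Corner} (hempty : t ≠ ∅) (huniv : t ≠ univ)
    (u : Side → R) :
    coverSum Side.ends (u ∘ Side.opp) tᶜ = coverSum Side.ends u t := by
  rw [coverSum_ends_eq_sum hempty huniv, coverSum_ends_eq_sum (by simpa) (by simpa)]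
  refine sum_equiv Side.opp_involutive.toPerm (fun d => ?_) fun d _ => rfl
  simp [Side.ends_opp, compl_eq_comm, eq_comm (a := tᶜ)]

theorem coverSum_ends_eq_zero {t : Finset Corner} (ht : #t.toLeft ≠ 1)
    (hempty : t ≠ ∅) (huniv : t ≠ univ) (u : Side → R) :
    coverSum Side.ends u t = 0 := by
  rw [coverSum_ends_eq_sum hempty huniv, filter_false_of_mem, sum_empty]
  rintro d - rfl
  exact ht d.card_toLeft_ends

/-- Both subtractions are truncated, so that at least one of the two powers is trivial. The common
factor `h` spares a division by `cycleSum u`, which may be a zero divisor. -/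
theorem exists_coverSum_ends_eq (t : Finset Corner) (u : Side → R) :
    ∃ h, coverSum Side.ends u t = cycleSum u ^ (#t.toLeft - 1) * h ∧
      coverSum Side.ends (u ∘ Side.opp) tᶜ = cycleSum u ^ (1 - #t.toLeft) * h := by
  have hopp : cycleSum (u ∘ Side.opp) = cycleSum u := by
    simp [cycleSum, Side.opp, mul_comm]
  by_cases hempty : t = ∅
  · have hcard : #(∅ : Finset Corner).toLeft = 0 := rfl
    exact ⟨1, by simp [hempty, hcard, coverSum_ends_empty, coverSum_ends_univ, hopp]⟩
  by_cases huniv : t = univ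
  · exact ⟨1, by simp [huniv, coverSum_ends_empty, coverSum_ends_univ]⟩
  rw [coverSum_ends_compl hempty huniv]
  by_cases ht : #t.toLeft = 1
  · exact ⟨coverSum Side.ends u t, by simp [ht]⟩
  · exact ⟨0, by simp [coverSum_ends_eq_zero ht hempty huniv]⟩

theorem prod_coverSum_ends {ι : Type*} [Fintype ι] (t : ι → Finset Corner) (u : Side → R)
    (ht : ∑ i, #(t i).toLeft = Fintype.card ι + 1) :
    ∏ i, coverSum Side.ends u (t i) =
      cycleSum u * ∏ i, coverSum Side.ends (u ∘ Side.opp) (t i)ᶜ := by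
  choose h hleft hright using fun i => exists_coverSum_ends_eq (t i) u
  have hexp : ∑ i, (#(t i).toLeft - 1) = ∑ i, (1 - #(t i).toLeft) + 1 := by
    have hbalance : ∑ i, (#(t i).toLeft - 1 + 1) = ∑ i, (1 - #(t i).toLeft + #(t i).toLeft) :=
      sum_congr rfl fun i _ => by omega
    simp only [sum_add_distrib, sum_const, card_univ, smul_eq_mul, mul_one] at hbalance
    omega
  simp only [hleft, hright, prod_mul_distrib, prod_pow_eq_pow_sum, hexp, pow_succ']
  ring

theorem coverSum_eq_prod_cycleSum_mul {ι κ W : Type*} [Fintype ι] [Fintype κ] [Fintype W]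
    [DecidableEq W] {corner : ι × κ → Corner ↪ W} {S S' : Finset W}
    (hcover : ∀ v, #{γ | v ∈ univ.map (corner γ)} =
      (if v ∈ S then 1 else 0) + if v ∈ S' then 1 else 0)
    (hcolumn : ∀ t : ι × κ → Finset Corner, IsExactCover (fun γ => (t γ).map (corner γ)) S univ →
      ∀ k, ∑ r, #(t (r, k)).toLeft = Fintype.card ι + 1)
    (u : κ → Side → R) :
    coverSum (fun x : (ι × κ) × Side => x.2.ends.map (corner x.1)) (fun x => u x.1.2 x.2) S =
      (∏ k, cycleSum (u k)) *
        coverSum (fun x : (ι × κ) × Side => x.2.ends.map (corner x.1))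
          (fun x => u x.1.2 x.2.opp) S' := by
  classical
  rw [coverSum_cells, coverSum_cells, mul_sum]
  refine sum_equiv (compl_involutive (α := ι × κ → Finset Corner)).toPerm (fun t => ?_)
    fun t ht => ?_
  · simpa using (isExactCover_compl_iff hcover).symm
  · simp only [mem_filter_univ] at ht
    simp only [Fintype.prod_prod_type_right, ← prod_mul_distrib]
    exact prod_congr rfl fun k _ => prod_coverSum_ends (fun r => t (r, k)) (u k) (hcolumn t ht k)

end Cycle

section Geometry

variable {n : ℕ}

theorem Vertex.ext {p q : Vertex n} (hrow : p.row = q.row) (hcol : p.col = q.col) : p = q :=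
  Subtype.ext (Prod.ext (Fin.ext hrow) (Fin.ext hcol))

theorem Vertex.odd_row_add_col (p : Vertex n) : Odd (p.row + p.col) :=
  p.2

theorem Vertex.row_le (p : Vertex n) : p.row ≤ 2 * n :=
  Nat.lt_succ_iff.1 p.1.1.2

theorem Vertex.col_le (p : Vertex n) : p.col ≤ 2 * n :=
  Nat.lt_succ_iff.1 p.1.2.2

/-- The row of a corner of a four-cycle within the `3 × 3` block of squares around its center. -/
def Corner.row : Corner → ℕ
  | .inl s => 2 * s.toNat
  | .inr _ => 1

/-- The column of a corner of a four-cycle within the `3 × 3` block of squares around its center. -/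
def Corner.col : Corner → ℕ
  | .inl _ => 1
  | .inr e => 2 * e.toNat

theorem Corner.row_le : ∀ c : Corner, c.row ≤ 2 := by
  decide

theorem Corner.col_le : ∀ c : Corner, c.col ≤ 2 := by
  decide

theorem Corner.odd_row_add_col : ∀ c : Corner, Odd (c.row + c.col) := by
  decide

theorem Corner.eq_of_row_eq_of_col_eq :
    ∀ c c' : Corner, c.row = c'.row → c.col = c'.col → c = c' := by
  decide

theorem Corner.exists_row_eq_col_eq {i j : ℕ} (hi : i ≤ 2) (hj : j ≤ 2) (hodd : Odd (i + j)) :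
    ∃ c : Corner, c.row = i ∧ c.col = j := by
  interval_cases i <;> interval_cases j <;> revert hodd <;> decide

/-- The four-cycles of the Aztec diamond of order `n`: `(r, k)` is the one around the black square
in row `2 * r + 1` and column `2 * k + 1`. -/
abbrev Cell (n : ℕ) : Type := Fin n × Fin n

/-- The four vertices of a four-cycle of the Aztec diamond. -/
def corner (γ : Cell n) : Corner ↪ Vertex n where
  toFun c := ⟨(⟨2 * γ.1 + c.row, by have := c.row_le; omega⟩,
    ⟨2 * γ.2 + c.col, by have := c.col_le; omega⟩), by
      have := c.odd_row_add_col
      simp only [Nat.odd_iff] at *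
      omega⟩
  inj' c c' h := by
    simp only [Subtype.mk.injEq, Prod.mk.injEq, Fin.mk.injEq, Nat.add_left_cancel_iff] at h
    exact c.eq_of_row_eq_of_col_eq c' h.1 h.2

theorem row_corner (γ : Cell n) (c : Corner) : (corner γ c).row = 2 * γ.1 + c.row :=
  rfl

theorem col_corner (γ : Cell n) (c : Corner) : (corner γ c).col = 2 * γ.2 + c.col :=
  rfl

theorem mem_map_corner_univ {γ : Cell n} {v : Vertex n} :
    v ∈ univ.map (corner γ) ↔
      (2 * γ.1 ≤ v.row ∧ v.row ≤ 2 * γ.1 + 2) ∧ 2 * γ.2 ≤ v.col ∧ v.col ≤ 2 * γ.2 + 2 := by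
  simp only [mem_map, mem_univ, true_and]
  constructor
  · rintro ⟨c, rfl⟩
    have := c.row_le
    have := c.col_le
    simp only [row_corner, col_corner]
    omega
  · rintro ⟨hrow, hcol⟩
    have hodd := v.odd_row_add_col
    obtain ⟨c, hc⟩ := Corner.exists_row_eq_col_eq (i := v.row - 2 * γ.1) (j := v.col - 2 * γ.2)
      (by omega) (by omega) (by simp only [Nat.odd_iff] at *; omega)
    refine ⟨c, Vertex.ext ?_ ?_⟩ <;> simp only [row_corner, col_corner] <;> omega

theorem diamond_adj_corner (γ : Cell n) (d : Side) :
    (diamond n).Adj (corner γ (.inl d.1)) (corner γ (.inr d.2)) := by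
  obtain ⟨s, e⟩ := d
  simp only [diamond, row_corner, col_corner]
  cases s <;> cases e <;> simp [Corner.row, Corner.col]

theorem exists_corner_eq_of_adj {p q : Vertex n} (hpq : (diamond n).Adj p q) (hp : Even p.row) :
    ∃ (γ : Cell n) (d : Side), corner γ (.inl d.1) = p ∧ corner γ (.inr d.2) = q := by
  have hodd := p.odd_row_add_col
  have := p.row_le
  have := p.col_le
  have := q.row_le
  have := q.col_le
  simp only [diamond, Nat.even_iff, Nat.odd_iff] at hpq hp hodd
  refine ⟨(⟨q.row / 2, by omega⟩, ⟨p.col / 2, by omega⟩),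
    (decide (q.row < p.row), decide (p.col < q.col)), Vertex.ext ?_ ?_, Vertex.ext ?_ ?_⟩ <;>
  simp only [row_corner, col_corner, Corner.row, Corner.col, Bool.toNat, Bool.cond_decide] <;>
  (try split_ifs) <;> omega

theorem corner_inl_ne_corner_inr (γ γ' : Cell n) (s e : Bool) :
    corner γ (.inl s) ≠ corner γ' (.inr e) := by
  intro h
  have hrow := congrArg Vertex.row h
  simp only [row_corner, Corner.row] at hrow
  omega

theorem eq_and_eq_of_corner_eq {γ γ' : Cell n} {d d' : Side}
    (hinl : corner γ (.inl d.1) = corner γ' (.inl d'.1))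
    (hinr : corner γ (.inr d.2) = corner γ' (.inr d'.2)) : γ = γ' ∧ d = d' := by
  have toNat_inj : ∀ b c : Bool, b.toNat = c.toNat → b = c := by decide
  have hrow := congrArg Vertex.row hinl
  have hrow' := congrArg Vertex.row hinr
  have hcol := congrArg Vertex.col hinl
  have hcol' := congrArg Vertex.col hinr
  simp only [row_corner, col_corner, Corner.row, Corner.col] at hrow hrow' hcol hcol'
  refine ⟨Prod.ext (Fin.ext ?_) (Fin.ext ?_), Prod.ext ?_ ?_⟩
  · omega
  · omega
  · exact toNat_inj _ _ (by omega)
  · exact toNat_inj _ _ (by omega)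

/-- The edge of the Aztec diamond that is the given side of the given four-cycle. -/
def edge (x : Cell n × Side) : (diamond n).edgeSet :=
  ⟨s(corner x.1 (.inl x.2.1), corner x.1 (.inr x.2.2)), diamond_adj_corner x.1 x.2⟩

theorem edge_bijective : Function.Bijective (edge (n := n)) := by
  constructor
  · rintro ⟨γ, d⟩ ⟨γ', d'⟩ h
    obtain ⟨hinl, hinr⟩ | ⟨hswap, -⟩ := Sym2.eq_iff.1 (congrArg Subtype.val h)
    · exact Prod.ext_iff.2 (eq_and_eq_of_corner_eq hinl hinr)
    · exact absurd hswap (corner_inl_ne_corner_inr _ _ _ _)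
  · rintro ⟨e, he⟩
    induction e with
    | _ p q =>
      wlog hp : Even p.row generalizing p q
      · have hq : Even q.row := by
          have hpq : p.row + 1 = q.row ∨ q.row + 1 = p.row := he.1
          simp only [Nat.even_iff] at hp ⊢
          omega
        obtain ⟨x, hx⟩ := this q p ((SimpleGraph.mem_edgeSet _).2 (SimpleGraph.Adj.symm he)) hq
        exact ⟨x, Subtype.ext ((congrArg Subtype.val hx).trans Sym2.eq_swap)⟩
      · obtain ⟨γ, d, rfl, rfl⟩ := exists_corner_eq_of_adj he hp
        exact ⟨(γ, d), rfl⟩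

theorem toFinset_edge (x : Cell n × Side) :
    (edge x : Sym2 (Vertex n)).toFinset = x.2.ends.map (corner x.1) := by
  rw [edge, Sym2.toFinset_mk_eq, Side.map_ends]

/-- The vertices in even rows of the board column through the centers of the `k`-th column of
four-cycles. -/
def axis (k : Fin n) : Fin (n + 1) ↪ Vertex n where
  toFun i := ⟨(⟨2 * i, by omega⟩, ⟨2 * k + 1, by omega⟩), by
    simp only [Nat.odd_iff]
    omega⟩
  inj' i j h := by
    simp only [Subtype.mk.injEq, Prod.mk.injEq, Fin.mk.injEq] at h
    exact Fin.ext (by omega)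

theorem mem_map_axis {k : Fin n} {v : Vertex n} :
    v ∈ univ.map (axis k) ↔ Even v.row ∧ v.col = 2 * k + 1 := by
  simp only [mem_map, mem_univ, true_and]
  constructor
  · rintro ⟨i, rfl⟩
    exact ⟨even_two_mul _, rfl⟩
  · rintro ⟨⟨i, hi⟩, hcol⟩
    have := v.row_le
    exact ⟨⟨i, by omega⟩, Vertex.ext ((two_mul i).trans hi.symm) hcol.symm⟩

theorem corner_mem_map_axis {k : Fin n} {γ : Cell n} {c : Corner} :
    corner γ c ∈ univ.map (axis k) ↔ γ.2 = k ∧ c.isLeft := by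
  rw [mem_map_axis, row_corner, col_corner, Nat.even_iff, Fin.ext_iff]
  cases c <;> simp only [Corner.row, Corner.col, Sum.isLeft] <;> simp

theorem card_axis_inter_map_corner (k : Fin n) (γ : Cell n) (t : Finset Corner) :
    #(univ.map (axis k) ∩ t.map (corner γ)) = if γ.2 = k then #t.toLeft else 0 := by
  have hfilter : univ.map (axis k) ∩ t.map (corner γ) =
      ({c ∈ t | γ.2 = k ∧ c.isLeft} : Finset Corner).map (corner γ) := by
    ext v
    simp only [mem_inter, mem_map (f := corner γ), mem_filter]
    constructor
    · rintro ⟨hv, c, hc, rfl⟩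
      exact ⟨c, ⟨hc, corner_mem_map_axis.1 hv⟩, rfl⟩
    · rintro ⟨c, ⟨hc, hv⟩, rfl⟩
      exact ⟨corner_mem_map_axis.2 hv, c, hc, rfl⟩
  rw [hfilter, card_map]
  split_ifs with hk
  · rw [← card_map (s := t.toLeft) Function.Embedding.inl]
    congr 1
    ext c
    cases c <;> simp [hk]
  · simp [hk]

theorem sum_card_toLeft_column {t : Cell n → Finset Corner}
    (ht : IsExactCover (fun γ => (t γ).map (corner γ)) univ univ) (k : Fin n) :
    ∑ r, #(t (r, k)).toLeft = n + 1 := by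
  have hsum := ht.sum_card_inter (subset_univ (univ.map (axis k)))
  simp only [card_axis_inter_map_corner] at hsum
  rw [Fintype.sum_prod_type_right, Fintype.sum_eq_single k] at hsum
  · simpa using hsum
  · intro k' hk'
    simp [hk']

end Geometry

section Interior

variable {m : ℕ}

/-- The embedding of the Aztec diamond of order `m` in that of order `m + 1` with the same center.
The sides of the four-cycles of the small diamond become sides of four-cycles of the large one, but
the position of a side within its four-cycle is reversed. -/
def shift : Vertex m ↪ Vertex (m + 1) where
  toFun v := ⟨(⟨v.row + 1, by have := v.row_le; omega⟩, ⟨v.col + 1, by have := v.col_le; omega⟩), by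
    have := v.odd_row_add_col
    simp only [Nat.odd_iff] at *
    omega⟩
  inj' p q h := by
    simp only [Subtype.mk.injEq, Prod.mk.injEq, Fin.mk.injEq, Nat.add_right_cancel_iff] at h
    exact Vertex.ext h.1 h.2

theorem row_shift (v : Vertex m) : (shift v).row = v.row + 1 :=
  rfl

theorem col_shift (v : Vertex m) : (shift v).col = v.col + 1 :=
  rfl

/-- The vertices of the Aztec diamond that do not lie on the border of the board. -/
def interior (m : ℕ) : Finset (Vertex (m + 1)) :=
  univ.map shift

theorem mem_interior {v : Vertex (m + 1)} :
    v ∈ interior m ↔ (0 < v.row ∧ v.row < 2 * m + 2) ∧ 0 < v.col ∧ v.col < 2 * m + 2 := by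
  simp only [interior, mem_map, mem_univ, true_and]
  constructor
  · rintro ⟨u, rfl⟩
    have := u.row_le
    have := u.col_le
    simp only [row_shift, col_shift]
    omega
  · rintro ⟨hrow, hcol⟩
    have hodd := v.odd_row_add_col
    refine ⟨⟨(⟨v.row - 1, by omega⟩, ⟨v.col - 1, by omega⟩), ?_⟩, Vertex.ext ?_ ?_⟩
    · simp only [Nat.odd_iff] at *
      omega
    · exact Nat.sub_add_cancel hrow.1
    · exact Nat.sub_add_cancel hcol.1

theorem card_filter_fin_le_le {i : ℕ} (hi : i ≤ 2 * (m + 1)) :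
    #{r : Fin (m + 1) | 2 * r ≤ i ∧ i ≤ 2 * r + 2} =
      if Even i ∧ 0 < i ∧ i < 2 * m + 2 then 2 else 1 := by
  split_ifs with h
  · obtain ⟨⟨j, rfl⟩, hpos, hlt⟩ := h
    rw [card_eq_two]
    refine ⟨⟨j - 1, by omega⟩, ⟨j, by omega⟩, by simp only [ne_eq, Fin.mk.injEq]; omega, ?_⟩
    ext r
    simp only [mem_filter_univ, mem_insert, mem_singleton, Fin.ext_iff]
    omega
  · rw [card_eq_one]
    simp only [Nat.even_iff] at h
    refine ⟨⟨(i - 1) / 2, by omega⟩, ?_⟩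
    ext r
    simp only [mem_filter_univ, mem_singleton, Fin.ext_iff]
    omega

theorem card_cells_mem (v : Vertex (m + 1)) :
    #{γ | v ∈ univ.map (corner γ)} =
      (if v ∈ univ then 1 else 0) + if v ∈ interior m then 1 else 0 := by
  have hprod : ({γ | v ∈ univ.map (corner γ)} : Finset (Cell (m + 1))) =
      ({r | 2 * r ≤ v.row ∧ v.row ≤ 2 * r + 2} : Finset (Fin (m + 1))) ×ˢ
        ({k | 2 * k ≤ v.col ∧ v.col ≤ 2 * k + 2} : Finset (Fin (m + 1))) := by
    ext γ
    simp only [mem_filter_univ, mem_map_corner_univ, mem_product]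
  have hodd := v.odd_row_add_col
  have hrow := v.row_le
  have hcol := v.col_le
  rw [hprod, card_product, card_filter_fin_le_le hrow, card_filter_fin_le_le hcol]
  simp only [mem_univ, if_true, mem_interior]
  simp only [Nat.even_iff, Nat.odd_iff] at *
  split_ifs <;> omega

/-- The side of a four-cycle of the large diamond occupied by a side of a four-cycle of the small
one. -/
def innerSide : Cell m × Side ↪ Cell (m + 1) × Side where
  toFun x := ((⟨x.1.1 + x.2.1.toNat, by have := x.2.1.toNat_lt; omega⟩,
    ⟨x.1.2 + x.2.2.toNat, by have := x.2.2.toNat_lt; omega⟩), x.2.opp)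
  inj' x x' h := by
    have hside : x.2 = x'.2 := Side.opp_involutive.injective (congrArg Prod.snd h)
    simp only [Prod.mk.injEq, Fin.mk.injEq, hside, Nat.add_right_cancel_iff] at h
    exact Prod.ext (Prod.ext (Fin.ext h.1.1) (Fin.ext h.1.2)) hside

theorem ends_innerSide (x : Cell m × Side) :
    (innerSide x).2.ends.map (corner (innerSide x).1) =
      (x.2.ends.map (corner x.1)).map shift := by
  have hinl : corner (innerSide x).1 (.inl (innerSide x).2.1) =
      shift (corner x.1 (.inr x.2.2)) := by
    obtain ⟨-, s, e⟩ := x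
    cases s <;> cases e <;> exact Vertex.ext rfl rfl
  have hinr : corner (innerSide x).1 (.inr (innerSide x).2.2) =
      shift (corner x.1 (.inl x.2.1)) := by
    obtain ⟨-, s, e⟩ := x
    cases s <;> cases e <;> exact Vertex.ext rfl rfl
  rw [Side.map_ends, Side.map_ends, map_insert, map_singleton, hinl, hinr, pair_comm]

theorem mem_range_innerSide {x : Cell (m + 1) × Side}
    (hx : x.2.ends.map (corner x.1) ⊆ interior m) : x ∈ Set.range innerSide := by
  obtain ⟨⟨r, k⟩, s, e⟩ := x
  have hinl : corner (r, k) (.inl s) ∈ interior m :=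
    hx (mem_map_of_mem _ (mem_insert_self _ _))
  have hinr : corner (r, k) (.inr e) ∈ interior m :=
    hx (mem_map_of_mem _ (mem_insert_of_mem (mem_singleton_self _)))
  simp only [mem_interior, row_corner, col_corner, Corner.row, Corner.col] at hinl hinr
  have := s.toNat_lt
  have := e.toNat_lt
  have hs : (!s).toNat = 1 - s.toNat := by cases s <;> rfl
  have he : (!e).toNat = 1 - e.toNat := by cases e <;> rfl
  refine ⟨((⟨r + s.toNat - 1, by omega⟩, ⟨k + e.toNat - 1, by omega⟩), Side.opp (s, e)),
    Prod.ext (Prod.ext (Fin.ext ?_) (Fin.ext ?_)) (Side.opp_involutive _)⟩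
  · simp only [innerSide, Side.opp, Function.Embedding.coeFn_mk]
    omega
  · simp only [innerSide, Side.opp, Function.Embedding.coeFn_mk]
    omega

end Interior


section Weight

variable {R : Type*} (x y z w : ℕ → R)

/-- The weights of the sides of a four-cycle that is given the variables of index `i`. -/
def cycleWeight (i : ℕ) : Side → R
  | (false, false) => x i
  | (false, true) => y i
  | (true, false) => z i
  | (true, true) => w i

theorem cycleWeight_innerSide {m : ℕ} (a : ℕ) (e : Cell m × Side) :
    cycleWeight x y z w (a + (innerSide e).1.2) (innerSide e).2.opp =
      cycleWeight x (fun i => y (i + 1)) z (fun i => w (i + 1)) (a + e.1.2) e.2 := by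
  obtain ⟨⟨r, k⟩, d⟩ := e
  fin_cases d <;> rfl

variable [CommRing R]

theorem weight_of_even_of_odd {n : ℕ} (a : ℕ) {p q : Vertex n} (hp : Even p.row) (hq : Odd q.row) :
    weight x y z w n a s(p, q) = sideWeight x y z w (a + p.col / 2) p q :=
  if_pos ⟨hp, hq⟩

theorem weight_edge {n : ℕ} (a : ℕ) (e : Cell n × Side) :
    weight x y z w n a (edge e) = cycleWeight x y z w (a + e.1.2) e.2 := by
  obtain ⟨⟨r, k⟩, s, e⟩ := e
  have hinl : Even (corner (r, k) (.inl s)).row :=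
    ⟨r + s.toNat, by simp only [row_corner, Corner.row]; omega⟩
  have hinr : Odd (corner (r, k) (.inr e)).row := ⟨r, rfl⟩
  have hcol : (corner (r, k) (.inl s)).col / 2 = k := by
    simp only [col_corner, Corner.col]
    omega
  rw [edge, weight_of_even_of_odd _ _ _ _ _ hinl hinr, hcol]
  cases s <;> cases e <;>
    simp [sideWeight, cycleWeight, row_corner, col_corner, Corner.row, Corner.col]

theorem M_eq_coverSum (n a : ℕ) :
    M x y z w n a = coverSum (fun e : Cell n × Side => e.2.ends.map (corner e.1))
      (fun e => cycleWeight x y z w (a + e.1.2) e.2) univ := by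
  rw [M, matchingSum_eq_coverSum (Equiv.ofBijective edge edge_bijective)]
  simp only [Equiv.ofBijective_apply, toFinset_edge, weight_edge]

theorem coverSum_interior (m a : ℕ) :
    coverSum (fun e : Cell (m + 1) × Side => e.2.ends.map (corner e.1))
        (fun e => cycleWeight x y z w (a + e.1.2) e.2.opp) (interior m) =
      M x (fun i => y (i + 1)) z (fun i => w (i + 1)) m a := by
  rw [M_eq_coverSum, interior,
    coverSum_map innerSide shift ends_innerSide fun _ => mem_range_innerSide]
  exact congrArg (coverSum _ · univ) (funext (cycleWeight_innerSide x y z w a))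

theorem M_succ (m a : ℕ) :
    M x y z w (m + 1) a =
      (∏ k ∈ range (m + 1), (x (a + k) * w (a + k) + y (a + k) * z (a + k))) *
        M x (fun i => y (i + 1)) z (fun i => w (i + 1)) m a := by
  rw [M_eq_coverSum, coverSum_eq_prod_cycleSum_mul card_cells_mem
    (fun t ht k => by rw [sum_card_toLeft_column ht, Fintype.card_fin])
    (fun k => cycleWeight x y z w (a + k)), coverSum_interior, prod_range]
  rfl

theorem M_zero (a : ℕ) : M x y z w 0 a = 1 := by
  have hempty : IsEmpty (Vertex 0) := ⟨fun v => by
    have hodd := v.odd_row_add_col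
    have hrow := v.row_le
    have hcol := v.col_le
    rw [Nat.odd_iff] at hodd
    omega⟩
  simp [M_eq_coverSum, coverSum, IsExactCover, prod_of_isEmpty]

theorem M_eq_prod (n a : ℕ) :
    M x y z w n a = ∏ j ∈ range n, ∏ i ∈ range (j + 1),
      (x (a + i) * w (a + j) + z (a + i) * y (a + j)) := by
  induction n generalizing y w with
  | zero => rw [M_zero, prod_range_zero]
  | succ m ih =>
    have hdiag : ∏ j ∈ range (m + 1), ∏ i ∈ range j,
        (x (a + i) * w (a + j) + z (a + i) * y (a + j)) =
        ∏ j ∈ range m, ∏ i ∈ range (j + 1),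
          (x (a + i) * w (a + j + 1) + z (a + i) * y (a + j + 1)) := by
      rw [prod_range_succ', prod_range_zero, mul_one]
      rfl
    rw [M_succ, ih, ← hdiag, ← prod_mul_distrib]
    refine prod_congr rfl fun j _ => ?_
    rw [prod_range_succ _ j, mul_comm (y _), mul_comm]

theorem M_succ_eq_mul_prod (n a : ℕ) :
    M x y z w (n + 1) a =
      M x y z w n a * ∏ i ∈ range (n + 1), (x (a + i) * w (a + n) + z (a + i) * y (a + n)) := by
  rw [M_eq_prod, M_eq_prod, prod_range_succ]

theorem M_condensation (n a : ℕ) :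
    M x y z w (n + 2) a * M x y z w n (a + 1) =
      (x a * w (a + n + 1) + y (a + n + 1) * z a) *
        (M x y z w (n + 1) a * M x y z w (n + 1) (a + 1)) := by
  rw [M_succ_eq_mul_prod _ _ _ _ (n + 1), M_succ_eq_mul_prod _ _ _ _ n (a + 1),
    prod_range_succ']
  simp only [add_zero, add_right_comm a 1, add_assoc]
  ring

end Weight

end Aztec

theorem mainTheorem8 {R : Type*} [CommRing R] (x y z w : ℕ → R) :
    (∀ n : ℕ, 2 ≤ n →
      Aztec.M x y z w n 1 * Aztec.M x y z w (n - 2) 2 =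
        (x 1 * w n + y n * z 1) * (Aztec.M x y z w (n - 1) 1 * Aztec.M x y z w (n - 1) 2)) ∧
    (∀ n : ℕ,
      Aztec.M x y z w n 1 =
        ∏ j ∈ Finset.Icc 1 n, ∏ i ∈ Finset.Icc 1 j, (x i * w j + z i * y j)) := by
  constructor
  · intro n hn
    obtain ⟨m, rfl⟩ := Nat.exists_eq_add_of_le' hn
    simpa [add_comm 1 m] using Aztec.M_condensation x y z w m 1
  · intro n
    have prod_Icc_one (k : ℕ) (f : ℕ → R) : ∏ i ∈ Icc 1 k, f i = ∏ i ∈ range k, f (1 + i) := by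
      rw [range_eq_Ico, prod_Ico_add, ← Ico_add_one_right_eq_Icc]
    simp only [Aztec.M_eq_prod, prod_Icc_one, add_comm 1]
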